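/- For a set $S\subseteq\{1,\dots,n\}$ let $W\in\mathbb{R}^{n\times n}$ be a symmetric random matrix whose entries $(W_{ij})_{i\le j}$ are independent, with $W_{ij}=+1$ if $i,j\in S$, and $W_{ij}$ uniform on $\{-1,+1\}$ otherwise; write $\mathbb{P}_S$ for its law. Let $G=G(W)$ be the graph on $\{1,\dots,n\}$ in which distinct $i,j$ are joined if and only if $W_{ij}=+1$ (an Erdős–Rényi graph of edge density $1/2$ to which a clique on $S$ has been added). An estimator $\hat S$ is a measurable map from matrices to subsets of $\{1,\dots,n\}$; it may depend on $n$ and $k$. Fix $\varepsilon>0$ and a sequence of integers $k=k_n$. (a) Suppose that $1\le k_n<2(1-\varepsilon)\log_2 n$ for all large $n$. Then for every sequence of estimators $\hat S_n$, if the hidden set $S$ is uniformly distributed over the $k_n$-element subsets of $\{1,\dots,n\}$, the probability that $\hat S_n(W)\ne S$ tends to one, i.e. $$\binom{n}{k_n}^{-1}\sum_{|S|=k_n}\mathbb{P}_S\bigl(\hat S_n(W)\neq S\bigr)\longrightarrow 1\qquad(n\to\infty).$$ (b) Conversely, suppose that $2(1+\varepsilon)\log_2 n<k_n\le n$ for all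 large $n$. Then there is a sequence of estimators $\hat S_n$, depending on $W$ only through $G$, which perform exhaustive search for a $k_n$-clique (that is, $\hat S_n$ is a clique of $G$ with $k_n$ vertices whenever $G$ has one), such that for every sequence of hidden sets $S_n\subseteq\{1,\dots,n\}$ with $|S_n|=k_n$ for all large $n$, $$\mathbb{P}_{S_n}\bigl(\hat S_n=S_n\bigr)\longrightarrow 1\qquad(n\to\infty).$$ -/

import Mathlib

open MeasureTheory Filter Topology
open scoped ENNReal

namespace HiddenClique

/-- The law of the entry indexed by the unordered pair `e` (pairs `s(i, i)` on the diagonal are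
included): `Q₁` if both end points lie in `S`, and `Q₀` otherwise. -/
noncomputable def entryLaw {n : ℕ} (Q₀ Q₁ : Measure ℝ) (S : Finset (Fin n))
    (e : Sym2 (Fin n)) : Measure ℝ :=
  open Classical in if ∀ i ∈ e, i ∈ S then Q₁ else Q₀

/-- The Borel σ-algebra (the product σ-algebra) on real matrices. -/
instance {n : ℕ} : MeasurableSpace (Matrix (Fin n) (Fin n) ℝ) :=
  inferInstanceAs (MeasurableSpace (Fin n → Fin n → ℝ))

/-- The symmetric matrix with prescribed entries `(i, j)`, `i ≤ j`. -/
def symMatrix {n : ℕ} (w : Sym2 (Fin n) → ℝ) : Matrix (Fin n) (Fin n) ℝ :=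
  Matrix.of fun i j => w s(i, j)

/-- The law of the symmetric random matrix `W` with hidden set `S`: the entries `W i j`, `i ≤ j`,
are independent, with law `Q₁` if `i, j ∈ S` and law `Q₀` otherwise. -/
noncomputable def hiddenSetLaw {n : ℕ} (Q₀ Q₁ : Measure ℝ) (S : Finset (Fin n)) :
    Measure (Matrix (Fin n) (Fin n) ℝ) :=
  (Measure.pi (entryLaw Q₀ Q₁ S)).map symMatrix

/-- The uniform distribution on `{-1, +1}`. -/
noncomputable def signLaw : Measure ℝ :=
  (2⁻¹ : ℝ≥0∞) • Measure.dirac (-1) + (2⁻¹ : ℝ≥0∞) • Measure.dirac 1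

/-- The law of the observed matrix in the hidden clique problem:
`Q₀ = (δ₋₁ + δ₊₁) / 2` and `Q₁ = δ₊₁`. -/
noncomputable def cliqueLaw {n : ℕ} (S : Finset (Fin n)) : Measure (Matrix (Fin n) (Fin n) ℝ) :=
  hiddenSetLaw signLaw (Measure.dirac 1) S

/-- The graph of a symmetric matrix: distinct `i`, `j` are joined if and only if
`W i j = +1`. -/
def graphOf {n : ℕ} (W : Matrix (Fin n) (Fin n) ℝ) : SimpleGraph (Fin n) :=
  SimpleGraph.fromRel fun i j => W i j = 1

/-- An estimator of the hidden set is a measurable function of the observed matrix (the finite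
set of subsets of the vertices carries the discrete σ-algebra). -/
def IsEstimator {n : ℕ} (T : Matrix (Fin n) (Fin n) ℝ → Finset (Fin n)) : Prop :=
  ∀ A : Finset (Fin n), MeasurableSet {W | T W = A}

/-- Exhaustive search for a clique on `k` vertices: whenever the graph has such a clique, one is
returned (no matter which one). -/
def IsExhaustiveSearch {n : ℕ} (k : ℕ) (F : SimpleGraph (Fin n) → Finset (Fin n)) : Prop :=
  ∀ G : SimpleGraph (Fin n), (∃ A, G.IsNClique k A) → G.IsNClique k (F G)

/-- The probability that `T` differs from the hidden set, when the hidden set is uniformly random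
among the `k`-element sets of vertices. -/
noncomputable def uniformFailureProb {n : ℕ} (k : ℕ)
    (T : Matrix (Fin n) (Fin n) ℝ → Finset (Fin n)) : ℝ :=
  ((n.choose k : ℕ) : ℝ)⁻¹ *
    ∑ S ∈ (Finset.univ : Finset (Fin n)).powersetCard k, (cliqueLaw S).real {W | T W ≠ S}

theorem measurable_symMatrix {n : ℕ} :
    Measurable (symMatrix : (Sym2 (Fin n) → ℝ) → Matrix (Fin n) (Fin n) ℝ) :=
  measurable_pi_lambda _ fun _ => measurable_pi_lambda _ fun _ => measurable_pi_apply _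

instance : IsProbabilityMeasure signLaw :=
  ⟨by simp [signLaw, ENNReal.inv_two_add_inv_two]⟩

instance {n : ℕ} (Q₀ Q₁ : Measure ℝ) [IsProbabilityMeasure Q₀] [IsProbabilityMeasure Q₁]
    (S : Finset (Fin n)) (e : Sym2 (Fin n)) : IsProbabilityMeasure (entryLaw Q₀ Q₁ S e) := by
  unfold entryLaw
  split_ifs <;> assumption

instance {n : ℕ} (S : Finset (Fin n)) : IsProbabilityMeasure (cliqueLaw S) :=
  Measure.isProbabilityMeasure_map measurable_symMatrix.aemeasurable

end HiddenClique

namespace HiddenClique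

variable {n : ℕ}

/-! Lower bound: planting a clique on `S` is conditioning pure noise on an event of probability `2 ^
(-(k + 1).choose 2)` (the diagonal counts), so `cliqueLaw S` is at most `2 ^ (k + 1).choose 2` times
the noise law. The events `T W = S` are disjoint, so their noise probabilities sum to at most 1, and
the average success probability is at most `2 ^ (k + 1).choose 2 / n.choose k`. Below the threshold
this tends to 0.

Upper bound: exhaustive search fails only if some other `k`-set `A` is a clique. With `l = (A \
S).card` there are at most `k.choose l * n ^ l` such sets, each a clique with probability `2 ^
(-(k.choose 2 - (k - l).choose 2))`. By `choose_mul_pow_mul_le` the product is at most `r ^ l`,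
where `r = 2 * n * √2 ^ (-(k - 1))`, so the union bound is a geometric series, and `r` tends to 0
above the threshold. -/

/-! ### Impossibility below the threshold -/

theorem signLaw_one : signLaw {1} = 2⁻¹ := by
  have h : (-1 : ℝ) ≠ 1 := by norm_num
  simp [signLaw, h]

theorem signLaw_restrict_one :
    signLaw.restrict {1} = (2⁻¹ : ℝ≥0∞) • Measure.dirac (1 : ℝ) := by
  have h : (-1 : ℝ) ≠ 1 := by norm_num
  ext s hs
  by_cases h1 : (1 : ℝ) ∈ s <;>
    simp [signLaw, h, h1]

theorem entryLaw_of_mem_sym2 (Q₀ Q₁ : Measure ℝ) {S : Finset (Fin n)} {e : Sym2 (Fin n)}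
    (he : e ∈ S.sym2) : entryLaw Q₀ Q₁ S e = Q₁ := by
  rw [Finset.mem_sym2_iff] at he
  simp only [entryLaw]
  exact if_pos he

theorem entryLaw_of_notMem_sym2 (Q₀ Q₁ : Measure ℝ) {S : Finset (Fin n)} {e : Sym2 (Fin n)}
    (he : e ∉ S.sym2) : entryLaw Q₀ Q₁ S e = Q₀ := by
  rw [Finset.mem_sym2_iff] at he
  simp only [entryLaw]
  exact if_neg he

/-- The law with a hidden clique is the law without one, conditioned on the clique. -/
theorem pi_entryLaw_eq_smul_restrict (S : Finset (Fin n)) :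
    Measure.pi (entryLaw signLaw (Measure.dirac 1) S) =
      (2 : ℝ≥0∞) ^ S.sym2.card • (Measure.pi fun _ : Sym2 (Fin n) => signLaw).restrict
        (Set.univ.pi fun e => if e ∈ S.sym2 then {1} else Set.univ) := by
  rw [Measure.restrict_pi_pi]
  refine Measure.pi_eq fun s _ => ?_
  rw [Measure.smul_apply, Measure.pi_pi, smul_eq_mul]
  have h2 : (2 : ℝ≥0∞) ^ S.sym2.card = ∏ e : Sym2 (Fin n), if e ∈ S.sym2 then 2 else 1 := by
    rw [Finset.prod_ite, Finset.prod_const_one, mul_one, Finset.prod_const,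
      Finset.filter_mem_eq_inter, Finset.univ_inter]
  rw [h2, ← Finset.prod_mul_distrib]
  refine Finset.prod_congr rfl fun e _ => ?_
  by_cases he : e ∈ S.sym2
  · rw [entryLaw_of_mem_sym2 _ _ he, if_pos he, if_pos he, signLaw_restrict_one,
      Measure.smul_apply, smul_eq_mul, ← mul_assoc,
      ENNReal.mul_inv_cancel two_ne_zero ENNReal.ofNat_ne_top, one_mul]
  · rw [entryLaw_of_notMem_sym2 _ _ he, if_neg he, if_neg he, Measure.restrict_univ, one_mul]

theorem cliqueLaw_le (S : Finset (Fin n)) {A : Set (Matrix (Fin n) (Fin n) ℝ)}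
    (hA : MeasurableSet A) :
    (cliqueLaw S).real A ≤ 2 ^ (S.card + 1).choose 2 *
      ((Measure.pi fun _ : Sym2 (Fin n) => signLaw).map symMatrix).real A := by
  rw [cliqueLaw, hiddenSetLaw, map_measureReal_apply measurable_symMatrix hA,
    map_measureReal_apply measurable_symMatrix hA, pi_entryLaw_eq_smul_restrict,
    measureReal_ennreal_smul_apply, Finset.card_sym2]
  simp only [ENNReal.toReal_pow, ENNReal.toReal_ofNat]
  gcongr
  exact ENNReal.toReal_mono (measure_ne_top _ _) (Measure.restrict_apply_le _ _)

/-- No estimator recovers a uniformly random clique with probability above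
`2 ^ (k + 1).choose 2 / n.choose k`. -/
theorem one_sub_le_uniformFailureProb {k : ℕ} (hk : k ≤ n)
    {T : Matrix (Fin n) (Fin n) ℝ → Finset (Fin n)} (hT : IsEstimator T) :
    1 - 2 ^ (k + 1).choose 2 / (n.choose k : ℝ) ≤ uniformFailureProb k T := by
  have hc : (0 : ℝ) < n.choose k := by exact_mod_cast Nat.choose_pos hk
  set μ := (Measure.pi fun _ : Sym2 (Fin n) => signLaw).map symMatrix with hμ
  have : IsProbabilityMeasure μ :=
    Measure.isProbabilityMeasure_map measurable_symMatrix.aemeasurable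
  have hsum : ∑ S ∈ (Finset.univ : Finset (Fin n)).powersetCard k, μ.real {W | T W = S} ≤ 1 := by
    rw [← measureReal_biUnion_finset ?_ fun S _ => hT S]
    · exact measureReal_le_one
    · intro S _ S' _ h
      exact Set.disjoint_left.2 fun W h1 h2 => h (h1.symm.trans h2)
  have hfail : ∀ S ∈ (Finset.univ : Finset (Fin n)).powersetCard k,
      1 - 2 ^ (k + 1).choose 2 * μ.real {W | T W = S} ≤ (cliqueLaw S).real {W | T W ≠ S} := by
    intro S hS
    have h1 : {W | T W ≠ S} = {W | T W = S}ᶜ := rfl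
    rw [h1, probReal_compl_eq_one_sub (hT S)]
    have := cliqueLaw_le S (hT S)
    rw [(Finset.mem_powersetCard.1 hS).2] at this
    linarith
  have h := Finset.sum_le_sum hfail
  rw [Finset.sum_sub_distrib, ← Finset.mul_sum, Finset.sum_const, Finset.card_powersetCard,
    Finset.card_univ, Fintype.card_fin, nsmul_eq_mul, mul_one] at h
  have h2 : (n.choose k : ℝ) - 2 ^ (k + 1).choose 2 ≤
      ∑ S ∈ (Finset.univ : Finset (Fin n)).powersetCard k, (cliqueLaw S).real {W | T W ≠ S} := by
    refine le_trans ?_ h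
    have := mul_le_mul_of_nonneg_left hsum (by positivity : (0 : ℝ) ≤ 2 ^ (k + 1).choose 2)
    linarith
  rw [uniformFailureProb, inv_mul_eq_div, le_div_iff₀ hc, sub_mul, div_mul_cancel₀ _ hc.ne', one_mul]
  exact h2

theorem uniformFailureProb_le_one {k : ℕ} (T : Matrix (Fin n) (Fin n) ℝ → Finset (Fin n)) :
    uniformFailureProb k T ≤ 1 := by
  have h := Finset.sum_le_card_nsmul ((Finset.univ : Finset (Fin n)).powersetCard k)
    (fun S => (cliqueLaw S).real {W | T W ≠ S}) 1 fun _ _ => measureReal_le_one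
  rw [Finset.card_powersetCard, Finset.card_univ, Fintype.card_fin, nsmul_eq_mul, mul_one] at h
  rw [uniformFailureProb, inv_mul_eq_div]
  exact div_le_one_of_le₀ h (Nat.cast_nonneg _)

theorem two_pow_eq_sqrt_two_pow (m : ℕ) : (2 : ℝ) ^ m = √2 ^ (2 * m) := by
  rw [pow_mul, Real.sq_sqrt zero_le_two]

theorem two_pow_choose_two_div_choose_le {k : ℕ} (hk : 2 * k ≤ n) :
    2 ^ (k + 1).choose 2 / (n.choose k : ℝ) ≤ (2 * k * √2 ^ (k + 1) / n) ^ k := by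
  rcases Nat.eq_zero_or_pos k with rfl | hk0
  · simp
  have hn : (0 : ℝ) < n := by exact_mod_cast (by omega : 0 < n)
  have hc : (0 : ℝ) < n.choose k := by exact_mod_cast Nat.choose_pos (by omega : k ≤ n)
  have h1 : (2 : ℝ) ^ (k + 1).choose 2 = (√2 ^ (k + 1)) ^ k := by
    rw [two_pow_eq_sqrt_two_pow, ← pow_mul, Nat.choose_two_right,
      Nat.mul_div_cancel' (Nat.even_mul_pred_self (k + 1)).two_dvd, Nat.add_sub_cancel]
  -- Each factor of the falling factorial is at least `n + 1 - k ≥ n / 2`, and `k! ≤ k ^ k`.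
  have h2 : (n / 2 : ℝ) ^ k ≤ k ^ k * n.choose k := by
    have h3 := Nat.pow_le_choose (α := ℝ) k n
    rw [div_le_iff₀ (by positivity)] at h3
    calc (n / 2 : ℝ) ^ k ≤ ((n + 1 - k : ℕ) : ℝ) ^ k := by
          gcongr
          rw [div_le_iff₀ two_pos]
          exact_mod_cast (by omega : n ≤ (n + 1 - k) * 2)
      _ ≤ n.choose k * k.factorial := by exact_mod_cast h3
      _ ≤ n.choose k * k ^ k := by
          gcongr
          exact_mod_cast Nat.factorial_le_pow k
      _ = _ := mul_comm _ _
  rw [h1, div_le_iff₀ hc, div_pow, mul_pow, mul_pow]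
  rw [div_pow, div_le_iff₀ (by positivity)] at h2
  rw [div_mul_eq_mul_div, le_div_iff₀ (by positivity)]
  have := mul_le_mul_of_nonneg_left h2 (by positivity : (0 : ℝ) ≤ (√2 ^ (k + 1)) ^ k)
  linarith

theorem sqrt_two_pow_eq_rpow (m : ℕ) : √2 ^ m = (2 : ℝ) ^ ((m : ℝ) / 2) := by
  rw [Real.sqrt_eq_rpow, ← Real.rpow_natCast, ← Real.rpow_mul zero_le_two]
  congr 1
  ring

theorem rpow_mul_logb {x : ℝ} (hx : 0 < x) (c : ℝ) : (2 : ℝ) ^ (c * Real.logb 2 x) = x ^ c := by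
  rw [mul_comm, Real.rpow_mul zero_le_two, Real.rpow_logb two_pos (by norm_num) hx]

theorem tendsto_uniformFailureProb {ε : ℝ} (hε : 0 < ε) {k : ℕ → ℕ}
    (hk : ∀ᶠ n : ℕ in atTop, 1 ≤ k n ∧ (k n : ℝ) < 2 * (1 - ε) * Real.logb 2 n)
    {T : ∀ n : ℕ, Matrix (Fin n) (Fin n) ℝ → Finset (Fin n)} (hT : ∀ n, IsEstimator (T n)) :
    Tendsto (fun n => uniformFailureProb (k n) (T n)) atTop (𝓝 1) := by
  set r : ℕ → ℝ := fun n => 4 * √2 / Real.log 2 * (Real.log n / (n : ℝ) ^ ε) with hr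
  have hr0 : Tendsto r atTop (𝓝 0) := by
    have h := ((isLittleO_log_rpow_atTop hε).tendsto_div_nhds_zero).comp
      (tendsto_natCast_atTop_atTop (R := ℝ))
    simpa using h.const_mul (4 * √2 / Real.log 2)
  have hlow : Tendsto (fun n => 1 - r n) atTop (𝓝 1) := by simpa using hr0.const_sub 1
  refine tendsto_of_tendsto_of_tendsto_of_le_of_le' hlow tendsto_const_nhds ?_
    (Eventually.of_forall fun n => uniformFailureProb_le_one _)
  filter_upwards [hk, eventually_gt_atTop 0, hr0.eventually_le_const one_pos] with n ⟨hk1, hk2⟩ hn hrn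
  have hn' : (0 : ℝ) < n := by exact_mod_cast hn
  have hlog : 0 ≤ Real.logb 2 n := Real.logb_nonneg one_lt_two (by exact_mod_cast hn)
  have hbase : 2 * k n * √2 ^ (k n + 1) / n ≤ r n := by
    have h1 : √2 ^ (k n) ≤ (n : ℝ) ^ (1 - ε) := by
      rw [sqrt_two_pow_eq_rpow, ← rpow_mul_logb hn']
      exact Real.rpow_le_rpow_of_exponent_le one_le_two (by linarith)
    have h2 : (k n : ℝ) ≤ 2 * Real.logb 2 n := by nlinarith
    calc 2 * k n * √2 ^ (k n + 1) / n
        ≤ 2 * (2 * Real.logb 2 n) * ((n : ℝ) ^ (1 - ε) * √2) / n := by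
          rw [pow_succ]
          gcongr
      _ = r n := by
          rw [hr, Real.rpow_sub hn', Real.rpow_one, Real.logb]
          field_simp
          ring
  -- Already forced by the base being at most 1.
  have h2k : 2 * k n ≤ n := by
    have h1 : 2 * k n * √2 ^ (k n + 1) ≤ (n : ℝ) := by
      have := hbase.trans hrn
      rwa [div_le_one hn'] at this
    have h2 : (1 : ℝ) ≤ √2 ^ (k n + 1) := one_le_pow₀ (Real.one_le_sqrt.2 one_le_two)
    have h3 : (2 * k n : ℝ) ≤ n := (le_mul_of_one_le_right (by positivity) h2).trans h1
    exact_mod_cast h3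
  have h3 : (2 : ℝ) ^ (k n + 1).choose 2 / (n.choose (k n) : ℝ) ≤ r n := by
    refine (two_pow_choose_two_div_choose_le h2k).trans (le_trans ?_ hbase)
    -- Since `1 ≤ k n` and the base is at most 1, the power is at most the base.
    exact pow_le_of_le_one (by positivity) (hbase.trans hrn) (by omega)
  exact (sub_le_sub_left h3 1).trans (one_sub_le_uniformFailureProb (by omega) (hT n))

/-! ### Probability that a given set is a clique -/

/-- The edges of the complete graph on `A`. -/
def edgesWithin (A : Finset (Fin n)) : Finset (Sym2 (Fin n)) :=
  A.offDiag.image Sym2.mk.uncurry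

theorem mk_mem_edgesWithin {A : Finset (Fin n)} {i j : Fin n} :
    s(i, j) ∈ edgesWithin A ↔ (i ∈ A ∧ j ∈ A) ∧ i ≠ j := by
  simp only [edgesWithin, Finset.mem_image, Finset.mem_offDiag, Prod.exists,
    Function.uncurry_apply_pair, Sym2.eq_iff]
  grind

theorem edgesWithin_inter (A S : Finset (Fin n)) :
    edgesWithin (A ∩ S) = edgesWithin A ∩ S.sym2 := by
  ext e
  induction e with
  | _ i j =>
    simp only [Finset.mem_inter, mk_mem_edgesWithin, Finset.mk_mem_sym2_iff]
    tauto

theorem card_edgesWithin_sdiff (A S : Finset (Fin n)) :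
    (edgesWithin A \ S.sym2).card = A.card.choose 2 - (A ∩ S).card.choose 2 := by
  rw [Finset.card_sdiff, Finset.inter_comm, ← edgesWithin_inter, edgesWithin, edgesWithin,
    Sym2.card_image_offDiag, Sym2.card_image_offDiag]

theorem graphOf_symMatrix_adj {w : Sym2 (Fin n) → ℝ} {i j : Fin n} :
    (graphOf (symMatrix w)).Adj i j ↔ i ≠ j ∧ w s(i, j) = 1 := by
  simp [graphOf, symMatrix, SimpleGraph.fromRel_adj, Sym2.eq_swap (a := j)]

theorem isClique_graphOf_symMatrix {w : Sym2 (Fin n) → ℝ} {A : Finset (Fin n)} :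
    (graphOf (symMatrix w)).IsClique (A : Set (Fin n)) ↔ ∀ e ∈ edgesWithin A, w e = 1 := by
  constructor
  · intro h e
    induction e with
    | _ i j =>
      intro he
      obtain ⟨⟨hi, hj⟩, hij⟩ := mk_mem_edgesWithin.1 he
      exact (graphOf_symMatrix_adj.1 (h hi hj hij)).2
  · intro h i hi j hj hij
    exact graphOf_symMatrix_adj.2 ⟨hij, h _ (mk_mem_edgesWithin.2 ⟨⟨hi, hj⟩, hij⟩)⟩

theorem measurableSet_graphOf (p : SimpleGraph (Fin n) → Prop) :
    MeasurableSet {W : Matrix (Fin n) (Fin n) ℝ | p (graphOf W)} := by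
  have hentry (i j : Fin n) : MeasurableSet {W : Matrix (Fin n) (Fin n) ℝ | W i j = 1} :=
    have h : Measurable fun W : Fin n → Fin n → ℝ => W i j :=
      (measurable_pi_apply j).comp (measurable_pi_apply i)
    h (measurableSet_singleton (1 : ℝ))
  have hadj (i j : Fin n) :
      MeasurableSet {W : Matrix (Fin n) (Fin n) ℝ | (graphOf W).Adj i j} := by
    simp only [graphOf, SimpleGraph.fromRel_adj]
    exact (MeasurableSet.const _).inter ((hentry i j).union (hentry j i))
  have hgraph (G : SimpleGraph (Fin n)) :
      MeasurableSet {W : Matrix (Fin n) (Fin n) ℝ | graphOf W = G} := by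
    have h : {W : Matrix (Fin n) (Fin n) ℝ | graphOf W = G} =
        ⋂ i, ⋂ j, {W | (graphOf W).Adj i j ↔ G.Adj i j} := by
      ext W
      simp [SimpleGraph.ext_iff, funext_iff]
    rw [h]
    exact MeasurableSet.iInter fun i => MeasurableSet.iInter fun j =>
      (hadj i j).iff (MeasurableSet.const _)
  have h : {W : Matrix (Fin n) (Fin n) ℝ | p (graphOf W)} =
      ⋃ G ∈ {G | p G}, {W | graphOf W = G} := by
    ext W
    simp
  rw [h]
  exact MeasurableSet.biUnion (Set.to_countable _) fun G _ => hgraph G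

theorem entryLaw_singleton_one (S : Finset (Fin n)) (e : Sym2 (Fin n)) :
    entryLaw signLaw (Measure.dirac 1) S e {1} = if e ∈ S.sym2 then 1 else 2⁻¹ := by
  split_ifs with he
  · simp [entryLaw_of_mem_sym2 _ _ he]
  · rw [entryLaw_of_notMem_sym2 _ _ he, signLaw_one]

/-- Only the edges of `A` that do not lie within `S` are random, and each is present with
probability 1/2. -/
theorem cliqueLaw_isClique (S A : Finset (Fin n)) :
    (cliqueLaw S).real {W | (graphOf W).IsClique (A : Set (Fin n))} =
      2⁻¹ ^ (A.card.choose 2 - (A ∩ S).card.choose 2) := by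
  have hset : symMatrix ⁻¹' {W | (graphOf W).IsClique (A : Set (Fin n))} =
      (edgesWithin A : Set (Sym2 (Fin n))).pi fun _ => ({1} : Set ℝ) := by
    ext w
    simp [isClique_graphOf_symMatrix, Set.mem_pi]
  rw [cliqueLaw, hiddenSetLaw,
    map_measureReal_apply measurable_symMatrix (measurableSet_graphOf fun G => G.IsClique _), hset,
    measureReal_def, Measure.pi_pi_finset]
  simp only [entryLaw_singleton_one]
  rw [Finset.prod_ite, Finset.prod_const_one, one_mul, Finset.prod_const, ← Finset.sdiff_eq_filter,
    card_edgesWithin_sdiff]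
  simp

/-! ### Counting competing sets and the union bound -/

/-- `A` is determined by what it drops from `S` and what it adds, both of size `l`. -/
theorem card_filter_card_sdiff_le {k : ℕ} {S : Finset (Fin n)} (hS : S.card = k) (l : ℕ) :
    (((Finset.univ : Finset (Fin n)).powersetCard k).filter fun A => (A \ S).card = l).card ≤
      k.choose l * n ^ l := by
  calc _ ≤ (S.powersetCard l ×ˢ (Finset.univ : Finset (Fin n)).powersetCard l).card := by
        refine Finset.card_le_card_of_injOn (fun A => (S \ A, A \ S)) ?_ ?_
        · intro A hA
          simp only [Finset.coe_filter, Finset.mem_powersetCard_univ, Set.mem_ofPred_eq] at hA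
          simp only [Finset.coe_product, Set.mem_prod, Finset.mem_coe, Finset.mem_powersetCard,
            Finset.subset_univ, Finset.sdiff_subset, true_and]
          exact ⟨(Finset.card_sdiff_comm (hS.trans hA.1.symm)).trans hA.2, hA.2⟩
        · intro A _ B _ h
          simp only [Prod.mk.injEq, Finset.ext_iff, Finset.mem_sdiff] at h
          ext x
          have h1 := h.1 x
          have h2 := h.2 x
          tauto
    _ ≤ k.choose l * n ^ l := by
        rw [Finset.card_product, Finset.card_powersetCard, Finset.card_powersetCard, hS,
          Finset.card_univ, Fintype.card_fin]
        exact Nat.mul_le_mul_left _ (Nat.choose_le_pow n l)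

theorem succ_le_two_mul_sqrt_two_pow (j : ℕ) : (j + 1 : ℝ) ≤ 2 * √2 ^ j := by
  have h : (j + 1) ^ 2 ≤ 4 * 2 ^ j := by
    induction j with
    | zero => norm_num
    | succ j ih =>
      -- The inductive step needs `(j + 2) ^ 2 ≤ 2 * (j + 1) ^ 2`, which fails for `j < 2`.
      rcases Nat.lt_or_ge j 2 with hj | hj
      · interval_cases j <;> norm_num
      · rw [pow_succ 2 j]
        nlinarith
  refine le_of_sq_le_sq ?_ (by positivity)
  rw [mul_pow, ← pow_mul, mul_comm j 2, ← two_pow_eq_sqrt_two_pow]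
  norm_num
  exact_mod_cast h

/-- The crude bound `2 ^ (l + j)` suffices once `2 * j ≤ l * j`, that is for `l ≥ 2`; `l = 1` needs
the sharper linear estimate. -/
theorem choose_add_le_two_pow_mul (l j : ℕ) :
    ((l + j).choose l : ℝ) ≤ 2 ^ l * √2 ^ (l * j) := by
  rcases Nat.lt_or_ge l 2 with hl | hl
  · interval_cases l
    · simp
    · have := succ_le_two_mul_sqrt_two_pow j
      rw [Nat.choose_one_right]
      push_cast
      simpa [add_comm] using this
  · calc ((l + j).choose l : ℝ) ≤ 2 ^ (l + j) := by exact_mod_cast Nat.choose_le_two_pow _ _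
      _ = 2 ^ l * √2 ^ (2 * j) := by rw [pow_add, two_pow_eq_sqrt_two_pow j]
      _ ≤ _ := by
        gcongr
        exact Real.one_le_sqrt.2 one_le_two

theorem two_mul_choose_two_add (l j : ℕ) :
    2 * ((l + j).choose 2 - j.choose 2) = l * (l + j - 1) + l * j := by
  rcases Nat.eq_zero_or_pos l with rfl | hl
  · simp
  have h1 : 2 * (l + j).choose 2 = (l + j) * (l + j - 1) := by
    rw [Nat.choose_two_right, Nat.mul_div_cancel' (Nat.even_mul_pred_self _).two_dvd]
  have h2 : 2 * j.choose 2 = j * (j - 1) := by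
    rw [Nat.choose_two_right, Nat.mul_div_cancel' (Nat.even_mul_pred_self _).two_dvd]
  rw [Nat.mul_sub, h1, h2]
  obtain ⟨l, rfl⟩ := Nat.exists_eq_succ_of_ne_zero hl.ne'
  rcases j with _ | j
  · simp
  · have : l.succ + (j + 1) - 1 = l + j + 1 := by omega
    rw [this, Nat.add_sub_cancel, Nat.sub_eq_iff_eq_add (by nlinarith)]
    simp only [Nat.succ_eq_add_one]
    ring

/-- With `j = k - l`, twice the exponent is `l * (k - 1) + l * j`: the first part gives the `l`-th
power, the second absorbs the binomial coefficient up to `2 ^ l`. -/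
theorem choose_mul_pow_mul_le {k l : ℕ} (hl : l ≤ k) :
    (k.choose l * n ^ l : ℝ) * 2⁻¹ ^ (k.choose 2 - (k - l).choose 2) ≤
      (2 * n * (√2)⁻¹ ^ (k - 1)) ^ l := by
  obtain ⟨j, rfl⟩ := Nat.exists_eq_add_of_le hl
  have h := choose_add_le_two_pow_mul l j
  rw [Nat.add_sub_cancel_left, inv_pow, two_pow_eq_sqrt_two_pow, two_mul_choose_two_add, pow_add,
    mul_pow, mul_pow, inv_pow, inv_pow, ← pow_mul, mul_comm (l + j - 1) l]
  have h2 : (0 : ℝ) < √2 := by positivity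
  rw [← div_eq_mul_inv, ← div_eq_mul_inv, div_le_div_iff₀ (by positivity) (by positivity)]
  have := mul_le_mul_of_nonneg_right h
    (by positivity : (0 : ℝ) ≤ n ^ l * √2 ^ (l * (l + j - 1)))
  linarith

theorem sum_cliqueLaw_isClique_le {k : ℕ} {S : Finset (Fin n)} (hS : S.card = k)
    (hr : 2 * n * (√2)⁻¹ ^ (k - 1) ≤ (1 / 2 : ℝ)) :
    ∑ A ∈ ((Finset.univ : Finset (Fin n)).powersetCard k).erase S,
      (cliqueLaw S).real {W | (graphOf W).IsClique (A : Set (Fin n))} ≤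
        2 * (2 * n * (√2)⁻¹ ^ (k - 1)) := by
  set r : ℝ := 2 * n * (√2)⁻¹ ^ (k - 1) with hrdef
  have hr0 : 0 ≤ r := by positivity
  have hmaps : ∀ A ∈ ((Finset.univ : Finset (Fin n)).powersetCard k).erase S,
      (A \ S).card ∈ Finset.Ico 1 (k + 1) := by
    intro A hA
    obtain ⟨hne, hA⟩ := Finset.mem_erase.1 hA
    have hA := Finset.mem_powersetCard_univ.1 hA
    rw [Finset.mem_Ico, Nat.lt_succ_iff, Nat.one_le_iff_ne_zero]
    refine ⟨fun h => hne ?_, hA ▸ Finset.card_le_card Finset.sdiff_subset⟩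
    exact Finset.eq_of_subset_of_card_le
      (Finset.sdiff_eq_empty_iff_subset.1 (Finset.card_eq_zero.1 h)) (hS.trans hA.symm).le
  calc _ = ∑ A ∈ ((Finset.univ : Finset (Fin n)).powersetCard k).erase S,
        (2⁻¹ : ℝ) ^ (k.choose 2 - (k - (A \ S).card).choose 2) := by
        refine Finset.sum_congr rfl fun A hA => ?_
        have hA := Finset.mem_powersetCard_univ.1 (Finset.mem_of_mem_erase hA)
        have h := Finset.card_sdiff_add_card_inter A S
        rw [cliqueLaw_isClique, hA, show k - (A \ S).card = (A ∩ S).card by omega]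
    _ = ∑ l ∈ Finset.Ico 1 (k + 1),
        ∑ A ∈ (((Finset.univ : Finset (Fin n)).powersetCard k).erase S).filter
          (fun A => (A \ S).card = l), (2⁻¹ : ℝ) ^ (k.choose 2 - (k - l).choose 2) :=
        (Finset.sum_fiberwise_of_maps_to' hmaps
          fun l => (2⁻¹ : ℝ) ^ (k.choose 2 - (k - l).choose 2)).symm
    _ ≤ ∑ l ∈ Finset.Ico 1 (k + 1), r ^ l := by
        refine Finset.sum_le_sum fun l hl => ?_
        rw [Finset.sum_const, nsmul_eq_mul]
        refine le_trans ?_ (choose_mul_pow_mul_le (Nat.lt_succ_iff.1 (Finset.mem_Ico.1 hl).2))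
        gcongr
        refine le_trans (Nat.cast_le.2 ((Finset.card_le_card (Finset.filter_subset_filter _
          (Finset.erase_subset _ _))).trans (card_filter_card_sdiff_le hS l))) ?_
        push_cast
        rfl
    _ ≤ r ^ 1 / (1 - r) := geom_sum_Ico_le_of_lt_one hr0 (by linarith)
    -- Here `r ≤ 1/2` enters.
    _ ≤ 2 * r := by
        rw [pow_one, div_le_iff₀ (by linarith)]
        nlinarith

/-! ### Success of exhaustive search above the threshold -/

theorem cliqueLaw_not_isClique_self (S : Finset (Fin n)) :
    (cliqueLaw S).real {W | ¬ (graphOf W).IsClique (S : Set (Fin n))} = 0 := by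
  have h : {W : Matrix (Fin n) (Fin n) ℝ | ¬ (graphOf W).IsClique (S : Set (Fin n))} =
      {W | (graphOf W).IsClique (S : Set (Fin n))}ᶜ := rfl
  rw [h, probReal_compl_eq_one_sub (measurableSet_graphOf fun G => G.IsClique _),
    cliqueLaw_isClique, Finset.inter_self]
  simp

theorem one_sub_le_cliqueLaw_exhaustiveSearch {k : ℕ} {S : Finset (Fin n)} (hS : S.card = k)
    {F : SimpleGraph (Fin n) → Finset (Fin n)} (hF : IsExhaustiveSearch k F)
    (hr : 2 * n * (√2)⁻¹ ^ (k - 1) ≤ (1 / 2 : ℝ)) :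
    1 - 2 * (2 * n * (√2)⁻¹ ^ (k - 1)) ≤ (cliqueLaw S).real {W | F (graphOf W) = S} := by
  have hsub : {W | F (graphOf W) = S}ᶜ ⊆ {W | ¬ (graphOf W).IsClique (S : Set (Fin n))} ∪
      ⋃ A ∈ ((Finset.univ : Finset (Fin n)).powersetCard k).erase S,
        {W | (graphOf W).IsClique (A : Set (Fin n))} := by
    intro W hW
    by_cases h : (graphOf W).IsClique (S : Set (Fin n))
    · have hFW := hF (graphOf W) ⟨S, h, hS⟩
      exact Or.inr (Set.mem_biUnion (Finset.mem_erase.2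
        ⟨hW, Finset.mem_powersetCard_univ.2 hFW.card_eq⟩) hFW.isClique)
    · exact Or.inl h
  have h := (measureReal_mono (μ := cliqueLaw S) hsub).trans (measureReal_union_le _ _)
  rw [cliqueLaw_not_isClique_self, zero_add,
    probReal_compl_eq_one_sub (measurableSet_graphOf fun G => F G = S)] at h
  have := (h.trans (measureReal_biUnion_finset_le _ _)).trans (sum_cliqueLaw_isClique_le hS hr)
  linarith

theorem two_mul_inv_sqrt_two_pow_le {ε : ℝ} {k : ℕ} (hn : 0 < n)
    (hk : 2 * (1 + ε) * Real.logb 2 n < k) :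
    2 * n * (√2)⁻¹ ^ (k - 1) ≤ 2 * √2 * ((n : ℝ) ^ ε)⁻¹ := by
  have hn' : (0 : ℝ) < n := by exact_mod_cast hn
  have h2 : (1 : ℝ) ≤ √2 := Real.one_le_sqrt.2 one_le_two
  have h1 : (n : ℝ) ^ (1 + ε) ≤ √2 ^ k := by
    rw [sqrt_two_pow_eq_rpow, ← rpow_mul_logb hn']
    exact Real.rpow_le_rpow_of_exponent_le one_le_two (by linarith)
  -- Only an inequality, because `k - 1` truncates at `k = 0`.
  have h3 : √2 ^ k ≤ √2 ^ (k - 1) * √2 := by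
    rw [← pow_succ]
    exact pow_le_pow_right₀ h2 (by omega)
  rw [Real.rpow_add hn', Real.rpow_one] at h1
  have hε : (0 : ℝ) < (n : ℝ) ^ ε := Real.rpow_pos_of_pos hn' ε
  rw [inv_pow, ← div_eq_mul_inv, ← div_eq_mul_inv, div_le_div_iff₀ (by positivity) hε]
  linarith

/-- A `k`-clique of the graph if there is one, and the empty set otherwise. -/
noncomputable def searchClique (k : ℕ) (G : SimpleGraph (Fin n)) : Finset (Fin n) :=
  open Classical in if h : ∃ A, G.IsNClique k A then h.choose else ∅

theorem isExhaustiveSearch_searchClique (k : ℕ) :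
    IsExhaustiveSearch k (searchClique k : SimpleGraph (Fin n) → Finset (Fin n)) := by
  intro G h
  rw [searchClique, dif_pos h]
  exact h.choose_spec

theorem tendsto_cliqueLaw_exhaustiveSearch {ε : ℝ} (hε : 0 < ε) {k : ℕ → ℕ}
    (hk : ∀ᶠ n : ℕ in atTop, 2 * (1 + ε) * Real.logb 2 n < (k n : ℝ))
    {F : ∀ n : ℕ, SimpleGraph (Fin n) → Finset (Fin n)}
    (hF : ∀ n, IsExhaustiveSearch (k n) (F n))
    {S : ∀ n : ℕ, Finset (Fin n)} (hS : ∀ᶠ n in atTop, (S n).card = k n) :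
    Tendsto (fun n => (cliqueLaw (S n)).real {W | F n (graphOf W) = S n}) atTop (𝓝 1) := by
  set r : ℕ → ℝ := fun n => 2 * √2 * ((n : ℝ) ^ ε)⁻¹ with hrdef
  have hr0 : Tendsto r atTop (𝓝 0) := by
    have h := ((tendsto_rpow_atTop hε).comp
      (tendsto_natCast_atTop_atTop (R := ℝ))).inv_tendsto_atTop
    simpa using h.const_mul (2 * √2)
  have hlow : Tendsto (fun n => 1 - 2 * r n) atTop (𝓝 1) := by
    simpa using (hr0.const_mul 2).const_sub 1
  refine tendsto_of_tendsto_of_tendsto_of_le_of_le' hlow tendsto_const_nhds ?_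
    (Eventually.of_forall fun n => measureReal_le_one)
  filter_upwards [hk, hS, eventually_gt_atTop 0, hr0.eventually_le_const one_half_pos]
    with n hkn hSn hn hrn
  have h := two_mul_inv_sqrt_two_pow_le hn hkn
  exact (by linarith : 1 - 2 * r n ≤ _).trans
    (one_sub_le_cliqueLaw_exhaustiveSearch hSn (hF n) (h.trans hrn))

end HiddenClique

theorem mainTheorem3 (ε : ℝ) (hε : 0 < ε) (k : ℕ → ℕ) :
    ((∀ᶠ n : ℕ in atTop, 1 ≤ k n ∧ (k n : ℝ) < 2 * (1 - ε) * Real.logb 2 n) →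
      ∀ T : ∀ n : ℕ, Matrix (Fin n) (Fin n) ℝ → Finset (Fin n),
        (∀ n, HiddenClique.IsEstimator (T n)) →
        Tendsto (fun n => HiddenClique.uniformFailureProb (k n) (T n)) atTop (𝓝 1)) ∧
    ((∀ᶠ n : ℕ in atTop, 2 * (1 + ε) * Real.logb 2 n < (k n : ℝ) ∧ k n ≤ n) →
      ∃ F : ∀ n : ℕ, SimpleGraph (Fin n) → Finset (Fin n),
        (∀ n, HiddenClique.IsExhaustiveSearch (k n) (F n)) ∧
        (∀ n, HiddenClique.IsEstimator fun W => F n (HiddenClique.graphOf W)) ∧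
        ∀ S : ∀ n : ℕ, Finset (Fin n), (∀ᶠ n in atTop, (S n).card = k n) →
          Tendsto (fun n => (HiddenClique.cliqueLaw (S n)).real
            {W | F n (HiddenClique.graphOf W) = S n}) atTop (𝓝 1)) := by
  refine ⟨fun hk T hT => HiddenClique.tendsto_uniformFailureProb hε hk hT, fun hk => ?_⟩
  have hF (n : ℕ) := HiddenClique.isExhaustiveSearch_searchClique (n := n) (k n)
  exact ⟨fun n => HiddenClique.searchClique (k n), hF,
    fun n A => HiddenClique.measurableSet_graphOf fun G => HiddenClique.searchClique (k n) G = A,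
    fun S hS => HiddenClique.tendsto_cliqueLaw_exhaustiveSearch hε
      (hk.mono fun _ h => h.1) hF hS⟩
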